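/- Let $A\in\mathbb{R}^{m\times n}$, let $\mathbb{S}^n$ be the space of real symmetric $n\times n$ matrices with the trace inner product $\langle X,Y\rangle=\operatorname{tr}(XY)$, let $\mathbb{S}^n_+$ be the cone of positive semidefinite matrices, and let $\mathcal{F}=\{X\in\mathbb{S}^n : AX=0\}$. Let $\Psi=\delta_{\mathcal{F}\cap\mathbb{S}^n_+}:\mathbb{S}^n\to\mathbb{R}\cup\{+\infty\}$ be the indicator function, equal to $0$ on $\mathcal{F}\cap\mathbb{S}^n_+$ and $+\infty$ elsewhere, and let $\partial\Psi$ be its convex subdifferential. For $X^*\in\mathcal{F}\cap\mathbb{S}^n_+$ put \[ \mathcal{M}=\{Y\in\mathbb{S}^n_+ : AY=0,\ \operatorname{rank}Y=\operatorname{rank}X^*\}. \] Then, for every $X^*\in\mathcal{F}\cap\mathbb{S}^n_+$, the function $\Psi$ is partly smooth at $X^*$ relative to $\mathcal{M}$. That is, $\Psi$ is convex, $X^*\in\mathcal{M}$, $\partial\Psi(X^*)\neq\emptyset$, and: \begin{enumerate} \item around $X^*$, $\mathcal{M}$ is a $C^2$-manifold (on an open neighbourhood of $X^*$ it is the zero set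 of a $C^2$ map into some $\mathbb{R}^k$ with surjective derivative), and $\Psi|_{\mathcal{M}}$ is $C^2$ around $X^*$ (near $X^*$ it agrees on $\mathcal{M}$ with a real-valued $C^2$ function on a neighbourhood of $X^*$ in $\mathbb{S}^n$); \item the affine span of $\partial\Psi(X^*)$ is a translate of the normal space to $\mathcal{M}$ at $X^*$, i.e. of the orthogonal complement of the tangent space; \item $\partial\Psi$ is continuous at $X^*$ relative to $\mathcal{M}$ in the Painlevé–Kuratowski sense: whenever $X_k\in\mathcal{M}$ and $X_k\to X^*$, every limit of a convergent sequence $S_k\in\partial\Psi(X_k)$ lies in $\partial\Psi(X^*)$, and every $S\in\partial\Psi(X^*)$ is the limit of a sequence $(S_k)$ with $S_k\in\partial\Psi(X_k)$ for all large $k$. \end{enumerate} -/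

import Mathlib

open Filter Topology
open scoped Matrix Matrix.Norms.Frobenius

noncomputable section

/-! ### The Euclidean space of real symmetric matrices -/

/-- The trace inner product `⟪X, Y⟫ = tr (Xᵀ Y)` on real square matrices; the norm it induces is
the Frobenius norm. -/
instance Matrix.frobeniusInnerProductSpace (n : ℕ) :
    InnerProductSpace ℝ (Matrix (Fin n) (Fin n) ℝ) where
  inner X Y := (Xᵀ * Y).trace
  norm_sq_eq_re_inner X := by
    have h : (0 : ℝ) ≤ ∑ i, ∑ j, X i j ^ 2 :=
      Finset.sum_nonneg fun i _ => Finset.sum_nonneg fun j _ => sq_nonneg _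
    rw [Matrix.frobenius_norm_def, ← Real.sqrt_eq_rpow]
    simp only [Real.rpow_two, Real.norm_eq_abs, sq_abs]
    rw [Real.sq_sqrt h, Finset.sum_comm]
    simp [Matrix.trace, Matrix.mul_apply, sq]
  conj_inner_symm X Y := by
    rw [← Matrix.trace_transpose]
    simp
  add_left X Y Z := by simp [Matrix.add_mul]
  smul_left X Y r := by simp

/-- The space `𝕊ⁿ` of real symmetric `n × n` matrices, with the trace inner product inherited from
all matrices. -/
abbrev SymMat (n : ℕ) : Type :=
  ↥({ carrier := {X | Xᵀ = X}
      add_mem' := fun {X Y} (hX : Xᵀ = X) (hY : Yᵀ = Y) => by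
        change (X + Y)ᵀ = X + Y
        rw [Matrix.transpose_add, hX, hY]
      zero_mem' := Matrix.transpose_zero
      smul_mem' := fun c X (hX : Xᵀ = X) => by
        change (c • X)ᵀ = c • X
        rw [Matrix.transpose_smul, hX] } : Submodule ℝ (Matrix (Fin n) (Fin n) ℝ))

/-- The cone `𝕊ⁿ₊` of positive semidefinite matrices. -/
def psdCone (n : ℕ) : Set (SymMat n) :=
  {X | (X : Matrix (Fin n) (Fin n) ℝ).PosSemidef}

/-- The subspace `ℱ = {X ∈ 𝕊ⁿ | A X = 0}`. -/
def facialSubspace {m n : ℕ} (A : Matrix (Fin m) (Fin n) ℝ) : Set (SymMat n) :=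
  {X | A * (X : Matrix (Fin n) (Fin n) ℝ) = 0}

/-- The set `{Y ∈ 𝕊ⁿ₊ | A Y = 0, rank Y = rank X}`. -/
def fixedRankFace {m n : ℕ} (A : Matrix (Fin m) (Fin n) ℝ) (X : SymMat n) : Set (SymMat n) :=
  {Y | Y ∈ psdCone n ∧ A * (Y : Matrix (Fin n) (Fin n) ℝ) = 0 ∧
    (Y : Matrix (Fin n) (Fin n) ℝ).rank = (X : Matrix (Fin n) (Fin n) ℝ).rank}

/-! ### Convex analysis in a Euclidean space -/

open Classical in
/-- The indicator function `δ_C` of convex analysis: `0` on `C` and `+∞` off `C`. -/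
def convexIndicator {E : Type*} (C : Set E) (x : E) : EReal :=
  if x ∈ C then 0 else ⊤

section

variable {E : Type*} [NormedAddCommGroup E] [InnerProductSpace ℝ E]

/-- Convexity of an extended-real-valued function: its epigraph is convex. -/
def IsConvexFun (f : E → EReal) : Prop :=
  Convex ℝ {p : E × ℝ | f p.1 ≤ (p.2 : EReal)}

/-- The subdifferential `∂f(x)` of convex analysis; it is empty where `f` is not finite. -/
def subdifferential (f : E → EReal) (x : E) : Set E :=
  {s | f x ≠ ⊥ ∧ f x ≠ ⊤ ∧ ∀ y, f x + ((inner ℝ s (y - x) : ℝ) : EReal) ≤ f y}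

/-- Around `x`, the set `M` is a `C²`-manifold: near `x` it is the zero set of finitely many `C²`
equations whose derivatives are linearly independent. -/
def IsC2ManifoldAround (M : Set E) (x : E) : Prop :=
  ∃ (k : ℕ) (V : Set E) (G : E → EuclideanSpace ℝ (Fin k)),
    IsOpen V ∧ x ∈ V ∧ ContDiffOn ℝ 2 G V ∧
      (∀ y ∈ V, Function.Surjective (fderiv ℝ G y)) ∧
      M ∩ V = {y | y ∈ V ∧ G y = 0}

/-- `f` restricted to `M` is `C²` around `x`: near `x` it agrees on `M` with a real-valued function
that is `C²` near `x` in the ambient space. -/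
def IsC2AlongAround (f : E → EReal) (M : Set E) (x : E) : Prop :=
  ∃ g : E → ℝ, ContDiffAt ℝ 2 g x ∧ ∀ᶠ y in 𝓝[M] x, f y = (g y : EReal)

/-- The velocities at `x` of the `C²` curves in `M` through `x`; when `M` is a `C²`-manifold around
`x ∈ M`, this is the tangent space to `M` at `x`. -/
def tangentVectors (M : Set E) (x : E) : Set E :=
  {v | ∃ γ : ℝ → E, γ 0 = x ∧ (∀ᶠ t in 𝓝 (0 : ℝ), γ t ∈ M) ∧
    ContDiffAt ℝ 2 γ 0 ∧ HasDerivAt γ v 0}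

/-- The normal space to `M` at `x`: the orthogonal complement of the tangent space. -/
def normalSpace (M : Set E) (x : E) : Submodule ℝ E :=
  (Submodule.span ℝ (tangentVectors M x))ᗮ

/-- Outer semicontinuity (Painlevé–Kuratowski) of a set-valued map at `x` relative to `M`. -/
def OuterSemicontinuousRel (T : E → Set E) (M : Set E) (x : E) : Prop :=
  ∀ (u s : ℕ → E) (y : E), (∀ k, u k ∈ M) → Tendsto u atTop (𝓝 x) →
    (∀ k, s k ∈ T (u k)) → Tendsto s atTop (𝓝 y) → y ∈ T x

/-- Inner semicontinuity (Painlevé–Kuratowski) of a set-valued map at `x` relative to `M`. -/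
def InnerSemicontinuousRel (T : E → Set E) (M : Set E) (x : E) : Prop :=
  ∀ (u : ℕ → E) (y : E), (∀ k, u k ∈ M) → Tendsto u atTop (𝓝 x) → y ∈ T x →
    ∃ s : ℕ → E, (∀ᶠ k in atTop, s k ∈ T (u k)) ∧ Tendsto s atTop (𝓝 y)

/-- The convex function `f` is partly smooth at `x` relative to the set `M ∋ x`. -/
structure IsPartlySmooth (f : E → EReal) (M : Set E) (x : E) : Prop where
  convex : IsConvexFun f
  mem : x ∈ M
  subdifferential_nonempty : (subdifferential f x).Nonempty
  manifold : IsC2ManifoldAround M x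
  smooth : IsC2AlongAround f M x
  sharp : ∃ a : E, affineSpan ℝ (subdifferential f x) = AffineSubspace.mk' a (normalSpace M x)
  outer : OuterSemicontinuousRel (subdifferential f) M x
  inner : InnerSemicontinuousRel (subdifferential f) M x

end

end

/-!
Let `P` be the orthogonal projection onto `ker A`, so that `P * Y * P` runs over the symmetric
matrices annihilated by `A`. Self-duality of the semidefinite cone shows that `S` is a subgradient
of the indicator function at `X` if and only if `P * S * X = 0` and `-P * S * P` is positive
semidefinite. The first condition holds on the whole normal space: congruences by `1 + t • E` with
`A * E = 0` move `X` inside the fixed-rank face, and `E = P * S * X` is the velocity that tests it.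

Near `X`, a symmetric matrix `Y` of the rank of `X` satisfies `Y = Y * G * Y`, where `G` inverts the
compression of `Y` to the range of `X`. Hence the face is there the fixed-point set of the smooth
idempotent map `Y ↦ P * Y * G * Y * P`, and the fixed-point set of a smooth retraction is a
manifold. Since `1 - Y * G` vanishes on the range of `Y`, it also transports the subgradients at `X`
continuously to subgradients at `Y`, which is inner semicontinuity; outer semicontinuity is a
passage to the limit in the subgradient inequality.
-/

section Analysis

theorem eventually_surjective_nhds {𝕜 E F : Type*} [NontriviallyNormedField 𝕜] [CompleteSpace 𝕜]
    [NormedAddCommGroup E] [NormedSpace 𝕜 E] [NormedAddCommGroup F] [NormedSpace 𝕜 F]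
    [FiniteDimensional 𝕜 F] {L : E →L[𝕜] F} (hL : Function.Surjective L) :
    ∀ᶠ L' in 𝓝 L, Function.Surjective (L' : E →L[𝕜] F) := by
  have : CompleteSpace F := FiniteDimensional.complete 𝕜 F
  obtain ⟨R, hR⟩ :=
    ContinuousLinearMap.HasRightInverse.of_surjective_of_finiteDimensional hL
  have hLR : L ∘L R = 1 := ContinuousLinearMap.ext hR
  have hcont : ContinuousAt (fun L' : E →L[𝕜] F => L' ∘L R) L :=
    (continuous_id.clm_comp continuous_const).continuousAt
  have hunit : {B : F →L[𝕜] F | IsUnit B} ∈ 𝓝 (L ∘L R) :=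
    Units.isOpen.mem_nhds (hLR ▸ isUnit_one)
  filter_upwards [hcont hunit] with L' hL'
  exact .of_comp (ContinuousLinearMap.isUnit_iff_bijective.1 hL').surjective

theorem contDiffAt_subtypeVal_comp_iff {𝕜 E F : Type*} [RCLike 𝕜] [NormedAddCommGroup E]
    [NormedSpace 𝕜 E] [NormedAddCommGroup F] [InnerProductSpace 𝕜 F] {K : Submodule 𝕜 F}
    [K.HasOrthogonalProjection] {f : E → K} {x : E} {k : WithTop ℕ∞} :
    ContDiffAt 𝕜 k (fun y => (f y : F)) x ↔ ContDiffAt 𝕜 k f x := by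
  refine ⟨fun h => ?_, fun h => K.subtypeL.contDiff.contDiffAt.comp x h⟩
  simpa [Function.comp_def] using K.orthogonalProjectionOnto.contDiff.contDiffAt.comp x h

section Retraction

variable {E : Type*} [NormedAddCommGroup E] [NormedSpace ℝ E] {ρ : E → E} {x : E}

theorem isIdempotentElem_fderiv_of_retraction (hρ : DifferentiableAt ℝ ρ x) (hx : ρ x = x)
    (hidem : ∀ᶠ y in 𝓝 x, ρ (ρ y) = ρ y) : IsIdempotentElem (fderiv ℝ ρ x) := by
  have hρ' : HasFDerivAt ρ (fderiv ℝ ρ x) (ρ x) := hx.symm ▸ hρ.hasFDerivAt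
  exact ((hρ'.comp x hρ.hasFDerivAt).congr_of_eventuallyEq
    (hidem.mono fun _ h => h.symm)).unique hρ.hasFDerivAt

-- With `T = ρ'(x)`, the map `Φ y = T (ρ y) + (1 - T) (y - ρ y)` has derivative
-- `T ^ 2 + (1 - T) ^ 2 = 1` at `x`, so it is injective near `x`; and `Φ y = Φ (ρ y)` as soon as the
-- second term vanishes.
theorem eventually_one_sub_fderiv_apply_sub_eq_zero_iff [CompleteSpace E]
    {k : WithTop ℕ∞} (hρ : ContDiffAt ℝ k ρ x) (hk : k ≠ 0) (hx : ρ x = x)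
    (hidem : ∀ᶠ y in 𝓝 x, ρ (ρ y) = ρ y) :
    ∀ᶠ y in 𝓝 x, (1 - fderiv ℝ ρ x) (y - ρ y) = 0 ↔ ρ y = y := by
  have hT := isIdempotentElem_fderiv_of_retraction (hρ.differentiableAt hk) hx hidem
  have hderiv := hρ.hasStrictFDerivAt hk
  set T := fderiv ℝ ρ x
  let Φ : E → E := fun y => T (ρ y) + (1 - T) (y - ρ y)
  have hone : T ∘L T + (1 - T) ∘L (ContinuousLinearMap.id ℝ E - T) =
      (ContinuousLinearEquiv.refl ℝ E : E →L[ℝ] E) := by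
    change T * T + (1 - T) * (1 - T) = 1
    rw [hT.eq, hT.one_sub.eq, add_sub_cancel]
  have hΦ : HasStrictFDerivAt Φ (ContinuousLinearEquiv.refl ℝ E : E →L[ℝ] E) x := by
    rw [← hone]
    exact (T.hasStrictFDerivAt.comp x hderiv).add
      ((1 - T).hasStrictFDerivAt.comp x ((hasStrictFDerivAt_id x).sub hderiv))
  have hρ_tendsto : Tendsto ρ (𝓝 x) (𝓝 x) := by simpa only [hx] using hρ.continuousAt.tendsto
  filter_upwards [hΦ.eventually_left_inverse, hρ_tendsto.eventually hΦ.eventually_left_inverse,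
    hidem] with y hy hρy hy_idem
  refine ⟨fun h => ?_, fun h => by simp [h]⟩
  have hΦ_eq : Φ (ρ y) = Φ y := by simp only [Φ, hy_idem, sub_self, map_zero, h]
  rw [← hρy, hΦ_eq, hy]

end Retraction

section Manifold

variable {E : Type*} [NormedAddCommGroup E] [InnerProductSpace ℝ E] {M : Set E} {x : E}

theorem isC2ManifoldAround_of_submersion {F : Type*} [NormedAddCommGroup F] [NormedSpace ℝ F]
    [FiniteDimensional ℝ F] {g : E → F} (hg : ContDiffAt ℝ 2 g x)
    (hsurj : Function.Surjective (fderiv ℝ g x)) (hM : ∀ᶠ y in 𝓝 x, y ∈ M ↔ g y = 0) :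
    IsC2ManifoldAround M x := by
  let e : F ≃L[ℝ] EuclideanSpace ℝ (Fin (Module.finrank ℝ F)) :=
    ContinuousLinearEquiv.ofFinrankEq finrank_euclideanSpace_fin.symm
  have hfderiv : ContinuousAt (fderiv ℝ g) x :=
    (hg.fderiv_right (m := 1) (by norm_num)).continuousAt
  have hnear := (hg.eventually (by simp)).and
    ((hfderiv.eventually (eventually_surjective_nhds hsurj)).and hM)
  obtain ⟨V, hV, hVopen, hxV⟩ := eventually_nhds_iff.1 hnear
  refine ⟨_, V, e ∘ g, hVopen, hxV,
    fun y hy => (e.contDiff.contDiffAt.comp y (hV y hy).1).contDiffWithinAt, fun y hy => ?_, ?_⟩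
  · rw [e.comp_fderiv]
    exact e.surjective.comp (hV y hy).2.1
  · ext y
    simp only [Set.mem_inter_iff, Set.mem_ofPred_eq, Function.comp_apply,
      map_eq_zero_iff _ e.injective]
    exact ⟨fun h => ⟨h.2, (hV y h.2).2.2.1 h.1⟩, fun h => ⟨(hV y h.1).2.2.2 h.2, h.1⟩⟩

theorem isC2ManifoldAround_of_retraction [FiniteDimensional ℝ E] {ρ : E → E}
    (hρ : ContDiffAt ℝ 2 ρ x) (hx : ρ x = x) (hidem : ∀ᶠ y in 𝓝 x, ρ (ρ y) = ρ y)
    (hM : ∀ᶠ y in 𝓝 x, y ∈ M ↔ ρ y = y) : IsC2ManifoldAround M x := by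
  have hdiff : DifferentiableAt ℝ ρ x := hρ.differentiableAt two_ne_zero
  have hT := isIdempotentElem_fderiv_of_retraction hdiff hx hidem
  have hzero := eventually_one_sub_fderiv_apply_sub_eq_zero_iff hρ two_ne_zero hx hidem
  set T := fderiv ℝ ρ x
  let N : E →L[ℝ] (1 - T : E →L[ℝ] E).range := (1 - T).rangeRestrict
  have hderiv : fderiv ℝ (fun y => N (y - ρ y)) x = N := by
    have hcomp : HasFDerivAt (fun y => N (y - ρ y)) (N ∘L (ContinuousLinearMap.id ℝ E - T)) x :=
      N.hasFDerivAt.comp x ((hasFDerivAt_id x).sub hdiff.hasFDerivAt)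
    rw [hcomp.fderiv]
    ext v
    exact congr($(hT.one_sub.eq) v)
  refine isC2ManifoldAround_of_submersion (g := fun y => N (y - ρ y))
    (N.contDiff.contDiffAt.comp x (contDiffAt_id.sub hρ)) ?_ ?_
  · rw [hderiv]
    exact (1 - T : E →L[ℝ] E).toLinearMap.surjective_rangeRestrict
  · filter_upwards [hM, hzero] with y hMy hy
    rw [hMy, ← hy, ← Submodule.coe_eq_zero]
    rfl

end Manifold

theorem innerSemicontinuousRel_of_forall_exists_continuousAt {E : Type*} [NormedAddCommGroup E]
    {M : Set E} {x : E} {T : E → Set E}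
    (h : ∀ s ∈ T x, ∃ σ : E → E, ContinuousAt σ x ∧ σ x = s ∧ ∀ᶠ y in 𝓝[M] x, σ y ∈ T y) :
    InnerSemicontinuousRel T M x := by
  intro u s hu hux hs
  obtain ⟨σ, hσ, rfl, hσT⟩ := h s hs
  exact ⟨σ ∘ u, (tendsto_nhdsWithin_iff.2 ⟨hux, .of_forall hu⟩).eventually hσT,
    hσ.tendsto.comp hux⟩

end Analysis

/-! ### Indicator functions of convex sets -/

theorem convexIndicator_of_mem {E : Type*} {C : Set E} {x : E} (hx : x ∈ C) :
    convexIndicator C x = 0 := if_pos hx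

theorem convexIndicator_of_notMem {E : Type*} {C : Set E} {x : E} (hx : x ∉ C) :
    convexIndicator C x = ⊤ := if_neg hx

section Indicator

variable {E : Type*} [NormedAddCommGroup E] [InnerProductSpace ℝ E] {C M : Set E} {x : E}

theorem isConvexFun_convexIndicator (hC : Convex ℝ C) : IsConvexFun (convexIndicator C) := by
  have h : {p : E × ℝ | convexIndicator C p.1 ≤ (p.2 : EReal)} = C ×ˢ Set.Ici (0 : ℝ) := by
    ext ⟨y, r⟩
    by_cases hy : y ∈ C
    · simp [convexIndicator_of_mem hy, hy]
    · simp [convexIndicator_of_notMem hy, hy]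
  rw [IsConvexFun, h]
  exact hC.prod (convex_Ici 0)

theorem mem_subdifferential_convexIndicator_iff (hx : x ∈ C) {s : E} :
    s ∈ subdifferential (convexIndicator C) x ↔ ∀ y ∈ C, inner ℝ s (y - x) ≤ 0 := by
  simp only [subdifferential, Set.mem_ofPred_eq, convexIndicator_of_mem hx, zero_add]
  refine ⟨fun h y hy => ?_, fun h => ⟨EReal.zero_ne_bot, EReal.zero_ne_top, fun y => ?_⟩⟩
  · have := h.2.2 y
    rw [convexIndicator_of_mem hy] at this
    exact_mod_cast this
  · by_cases hy : y ∈ C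
    · rw [convexIndicator_of_mem hy]
      exact_mod_cast h y hy
    · rw [convexIndicator_of_notMem hy]
      exact le_top

theorem zero_mem_subdifferential_convexIndicator (hx : x ∈ C) :
    (0 : E) ∈ subdifferential (convexIndicator C) x := by
  rw [mem_subdifferential_convexIndicator_iff hx]
  intro y _
  simp

theorem outerSemicontinuousRel_subdifferential_convexIndicator (hM : M ⊆ C) (hx : x ∈ C) :
    OuterSemicontinuousRel (subdifferential (convexIndicator C)) M x := by
  intro u s y hu hux hs hsy
  rw [mem_subdifferential_convexIndicator_iff hx]
  intro z hz
  refine le_of_tendsto (hsy.inner (tendsto_const_nhds.sub hux)) (.of_forall fun k => ?_)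
  exact (mem_subdifferential_convexIndicator_iff (hM (hu k))).1 (hs k) z hz

theorem subdifferential_convexIndicator_subset_normalSpace (hM : M ⊆ C) (hx : x ∈ C) :
    subdifferential (convexIndicator C) x ⊆ normalSpace M x := by
  intro s hs
  rw [mem_subdifferential_convexIndicator_iff hx] at hs
  rw [SetLike.mem_coe, normalSpace, Submodule.mem_orthogonal']
  intro v hv
  induction hv using Submodule.span_induction with
  | zero => exact inner_zero_right s
  | add v w _ _ hv hw => rw [inner_add_right, hv, hw, add_zero]
  | smul c v _ hv => rw [inner_smul_right, hv, mul_zero]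
  | mem v hv =>
    obtain ⟨γ, h0, hγ, -, hd⟩ := hv
    have hmax : IsLocalMax (fun t => inner ℝ s (γ t)) 0 := by
      filter_upwards [hγ] with t ht
      have h := hs _ (hM ht)
      rw [inner_sub_right] at h
      rw [h0]
      linarith
    have hd' : HasDerivAt (fun t => inner ℝ s (γ t)) (inner ℝ s v) 0 := by
      simpa using (hasDerivAt_const (0 : ℝ) s).inner ℝ hd
    exact hmax.hasDerivAt_eq_zero hd'

end Indicator

section KernelProjection

variable {𝕜 m n l : Type*} [RCLike 𝕜] [Fintype n] [DecidableEq n]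

/-- The orthogonal projection onto the kernel of `A`, as a matrix. -/
noncomputable def kernelProjection (A : Matrix m n 𝕜) : Matrix n n 𝕜 :=
  (Matrix.toEuclideanCLM (𝕜 := 𝕜) (n := n)).symm (Matrix.toLpLin 2 2 A).ker.starProjection

theorem isStarProjection_kernelProjection (A : Matrix m n 𝕜) :
    IsStarProjection (kernelProjection A) :=
  (isStarProjection_starProjection (U := (Matrix.toLpLin 2 2 A).ker)).map
    (Matrix.toEuclideanCLM (𝕜 := 𝕜) (n := n)).symm.toStarAlgHom

theorem kernelProjection_mulVec (A : Matrix m n 𝕜) (x : n → 𝕜) :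
    WithLp.toLp 2 (kernelProjection A *ᵥ x) =
      (Matrix.toLpLin 2 2 A).ker.starProjection (WithLp.toLp 2 x) := by
  rw [← Matrix.toEuclideanCLM_toLp, kernelProjection, StarAlgEquiv.apply_symm_apply]

theorem mul_kernelProjection (A : Matrix m n 𝕜) : A * kernelProjection A = 0 := by
  refine Matrix.ext_of_mulVec_single fun j => ?_
  have h := Submodule.starProjection_apply_mem (Matrix.toLpLin 2 2 A).ker
    (WithLp.toLp 2 (Pi.single j 1))
  rw [← kernelProjection_mulVec, LinearMap.mem_ker, Matrix.toLpLin_toLp, WithLp.toLp_eq_zero] at h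
  rw [← Matrix.mulVec_mulVec, Matrix.zero_mulVec]
  exact h

theorem kernelProjection_mulVec_eq_self {A : Matrix m n 𝕜} {x : n → 𝕜} (h : A *ᵥ x = 0) :
    kernelProjection A *ᵥ x = x := by
  apply WithLp.toLp_injective 2
  rw [kernelProjection_mulVec, Submodule.starProjection_eq_self_iff]
  simpa using h

theorem kernelProjection_mul_eq_self {A : Matrix m n 𝕜} {Y : Matrix n l 𝕜} (h : A * Y = 0) :
    kernelProjection A * Y = Y := by
  ext i j
  exact congrFun (kernelProjection_mulVec_eq_self (x := Y.col j) congr(Matrix.col $h j)) i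

end KernelProjection

theorem transpose_kernelProjection {m n : Type*} [Fintype n] [DecidableEq n] (A : Matrix m n ℝ) :
    (kernelProjection A)ᵀ = kernelProjection A :=
  (isStarProjection_kernelProjection A).isSelfAdjoint

section PosSemidef

open scoped ComplexOrder

variable {𝕜 n : Type*} [RCLike 𝕜] [Fintype n]

theorem trace_mul_nonneg_of_posSemidef {X Y : Matrix n n 𝕜} (hX : X.PosSemidef)
    (hY : Y.PosSemidef) : 0 ≤ (X * Y).trace := by
  obtain ⟨k, v, rfl⟩ := Matrix.posSemidef_iff_eq_sum_vecMulVec.1 hY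
  rw [Matrix.mul_sum, Matrix.trace_sum]
  refine Finset.sum_nonneg fun i _ => ?_
  rw [Matrix.mul_vecMulVec, Matrix.trace_vecMulVec, dotProduct_comm]
  exact hX.dotProduct_mulVec_nonneg (v i)

theorem posDef_add_kernelProjection [DecidableEq n] {X : Matrix n n 𝕜} (hX : X.PosSemidef) :
    (X + kernelProjection X).PosDef := by
  have hN := isStarProjection_kernelProjection X
  have hN_eq : (kernelProjection X)ᴴ * kernelProjection X = kernelProjection X := by
    rw [← Matrix.star_eq_conjTranspose, hN.isSelfAdjoint.star_eq, hN.isIdempotentElem.eq]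
  have hN_psd : (kernelProjection X).PosSemidef :=
    hN_eq ▸ Matrix.posSemidef_conjTranspose_mul_self _
  refine .of_dotProduct_mulVec_pos (hX.add hN_psd).isHermitian fun x hx =>
    ((hX.add hN_psd).dotProduct_mulVec_nonneg x).lt_of_ne' fun h => hx ?_
  rw [Matrix.add_mulVec, dotProduct_add, add_eq_zero_iff_of_nonneg
    (hX.dotProduct_mulVec_nonneg x) (hN_psd.dotProduct_mulVec_nonneg x),
    hX.dotProduct_mulVec_zero_iff, hN_psd.dotProduct_mulVec_zero_iff] at h
  rw [← kernelProjection_mulVec_eq_self h.1, h.2]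

end PosSemidef

theorem eventually_posDef_of_isHermitian {n : Type*} [Finite n] {M : Matrix n n ℝ}
    (hM : M.PosDef) : ∀ᶠ M' : Matrix n n ℝ in 𝓝 M, M'.IsHermitian → M'.PosDef := by
  have := Fintype.ofFinite n
  have hcont : Continuous fun z : Matrix n n ℝ × (n → ℝ) => z.2 ⬝ᵥ (z.1 *ᵥ z.2) :=
    continuous_snd.dotProduct (continuous_fst.matrix_mulVec continuous_snd)
  have hsphere : ∀ᶠ M' : Matrix n n ℝ in 𝓝 M,
      ∀ x ∈ Metric.sphere (0 : n → ℝ) 1, 0 < x ⬝ᵥ (M' *ᵥ x) :=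
    (isCompact_sphere 0 1).eventually_forall_of_forall_eventually fun x hx =>
      hcont.continuousAt.eventually_const_lt
        (hM.dotProduct_mulVec_pos (ne_zero_of_mem_unit_sphere ⟨x, hx⟩))
  filter_upwards [hsphere] with M' hM' hherm
  refine .of_dotProduct_mulVec_pos hherm fun x hx => ?_
  have hpos := hM' (‖x‖⁻¹ • x) (by simp [norm_smul, (norm_pos_iff.2 hx).ne'])
  rw [Matrix.mulVec_smul, smul_dotProduct, dotProduct_smul, smul_eq_mul, smul_eq_mul] at hpos
  exact pos_of_mul_pos_right (pos_of_mul_pos_right hpos (by positivity)) (by positivity)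

theorem contDiffAt_matrix_inv {n : Type*} [Fintype n] [DecidableEq n] {M : Matrix n n ℝ}
    (hM : IsUnit M) {k : WithTop ℕ∞} : ContDiffAt ℝ k (fun N : Matrix n n ℝ => N⁻¹) M := by
  obtain ⟨u, rfl⟩ := hM
  have : CompleteSpace (Matrix n n ℝ) := FiniteDimensional.complete ℝ _
  simpa only [Matrix.nonsing_inv_eq_ringInverse] using contDiffAt_ringInverse ℝ u

theorem exists_eq_mul_of_rank_le {K l m n : Type*} [Field K] [Fintype l] [Finite m] [Fintype n]
    {Y : Matrix m n K} {B : Matrix n l K} (h : Y.rank ≤ (Y * B).rank) :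
    ∃ W : Matrix l n K, Y = Y * B * W := by
  classical
  have hle : (Y * B).mulVecLin.range ≤ Y.mulVecLin.range := by
    rw [Matrix.mulVecLin_mul]
    exact LinearMap.range_comp_le_range _ _
  have hrange := Submodule.eq_of_le_of_finrank_le hle h
  have hcol (j : n) : ∃ w, (Y * B) *ᵥ w = Y.col j := by
    have hj : Y.col j ∈ Y.mulVecLin.range := ⟨Pi.single j 1, by simp⟩
    rwa [← hrange] at hj
  choose w hw using hcol
  exact ⟨Matrix.of fun i j => w j i, Matrix.ext fun i j => (congrFun (hw j) i).symm⟩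

/-! ### Inverting the compression of a matrix to the range of a projection -/

section CompressionInverse

section CommRing

variable {n R : Type*} [Fintype n] [DecidableEq n] [CommRing R]

/-- The compression `Q * Y * Q` of `Y` to the range of a projection `Q`, completed by the identity
on the kernel of `Q` so that it can be inverted in the algebra of all matrices. -/
def completedCompression (Q Y : Matrix n n R) : Matrix n n R :=
  Q * Y * Q + (1 - Q)

/-- The inverse of the compression of `Y` to the range of a projection `Q`, extended by zero to the
kernel of `Q`. It is meaningful only where `completedCompression Q Y` is a unit. -/
noncomputable def compressionInverse (Q Y : Matrix n n R) : Matrix n n R :=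
  Q * (completedCompression Q Y)⁻¹ * Q

variable {Q Y Y' : Matrix n n R}

theorem compressionInverse_congr (h : Q * Y * Q = Q * Y' * Q) :
    compressionInverse Q Y = compressionInverse Q Y' := by
  rw [compressionInverse, compressionInverse, completedCompression, completedCompression, h]

theorem mul_compressionInverse (hQ : IsIdempotentElem Q) :
    Q * compressionInverse Q Y = compressionInverse Q Y := by
  rw [compressionInverse, ← Matrix.mul_assoc, ← Matrix.mul_assoc, hQ.eq]

theorem compressionInverse_mul (hQ : IsIdempotentElem Q) :
    compressionInverse Q Y * Q = compressionInverse Q Y := by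
  rw [compressionInverse, Matrix.mul_assoc, hQ.eq]

theorem transpose_completedCompression (hQ : Qᵀ = Q) (hY : Yᵀ = Y) :
    (completedCompression Q Y)ᵀ = completedCompression Q Y := by
  simp [completedCompression, hQ, hY, Matrix.mul_assoc]

theorem transpose_compressionInverse (hQ : Qᵀ = Q) (hY : Yᵀ = Y) :
    (compressionInverse Q Y)ᵀ = compressionInverse Q Y := by
  simp [compressionInverse, Matrix.transpose_nonsing_inv, transpose_completedCompression hQ hY, hQ,
    Matrix.mul_assoc]

theorem completedCompression_mul (hQ : IsIdempotentElem Q) :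
    completedCompression Q Y * Q = Q * Y * Q := by
  rw [completedCompression, Matrix.add_mul, hQ.one_sub_mul_self, add_zero, Matrix.mul_assoc, hQ.eq]

theorem mul_completedCompression (hQ : IsIdempotentElem Q) :
    Q * completedCompression Q Y = Q * Y * Q := by
  rw [completedCompression, Matrix.mul_add, hQ.mul_one_sub_self, add_zero, ← Matrix.mul_assoc,
    ← Matrix.mul_assoc, hQ.eq]

theorem compressionInverse_mul_mul (hQ : IsIdempotentElem Q)
    (hu : IsUnit (completedCompression Q Y)) : compressionInverse Q Y * Y * Q = Q := by
  have hdet := (Matrix.isUnit_iff_isUnit_det _).1 hu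
  calc compressionInverse Q Y * Y * Q
      = Q * ((completedCompression Q Y)⁻¹ * (completedCompression Q Y * Q)) := by
        rw [completedCompression_mul hQ, compressionInverse]
        simp only [Matrix.mul_assoc]
    _ = Q := by rw [Matrix.nonsing_inv_mul_cancel_left _ _ hdet, hQ.eq]

theorem mul_mul_compressionInverse (hQ : IsIdempotentElem Q)
    (hu : IsUnit (completedCompression Q Y)) : Q * Y * compressionInverse Q Y = Q := by
  have hdet := (Matrix.isUnit_iff_isUnit_det _).1 hu
  calc Q * Y * compressionInverse Q Y
      = Q * completedCompression Q Y * (completedCompression Q Y)⁻¹ * Q := by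
        rw [mul_completedCompression hQ, compressionInverse]
        simp only [Matrix.mul_assoc]
    _ = Q := by rw [Matrix.mul_nonsing_inv_cancel_right _ _ hdet, hQ.eq]

theorem compressionInverse_mul_mul_compressionInverse (hQ : IsIdempotentElem Q)
    (hu : IsUnit (completedCompression Q Y)) :
    compressionInverse Q Y * Y * compressionInverse Q Y = compressionInverse Q Y := by
  calc compressionInverse Q Y * Y * compressionInverse Q Y
      = compressionInverse Q Y * Y * Q * compressionInverse Q Y := by
        rw [Matrix.mul_assoc _ Q, mul_compressionInverse hQ]
    _ = compressionInverse Q Y := by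
        rw [compressionInverse_mul_mul hQ hu, mul_compressionInverse hQ]

end CommRing

section Field

variable {n K : Type*} [Fintype n] [DecidableEq n] [Field K] {Q Y : Matrix n n K}

theorem rank_le_of_isUnit_completedCompression (hQ : IsIdempotentElem Q)
    (hu : IsUnit (completedCompression Q Y)) : Q.rank ≤ Y.rank := by
  calc Q.rank = (compressionInverse Q Y * Y * Q).rank := by rw [compressionInverse_mul_mul hQ hu]
    _ ≤ (compressionInverse Q Y * Y).rank := Matrix.rank_mul_le_left _ _
    _ ≤ Y.rank := Matrix.rank_mul_le_right _ _

-- `Y * Q` already has the rank of `Q`, hence of `Y`, so that `Y` factors through `Y * Q`.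
theorem mul_compressionInverse_mul_of_rank_le (hQ : IsIdempotentElem Q)
    (hu : IsUnit (completedCompression Q Y)) (hY : Y.rank ≤ Q.rank) :
    Y * compressionInverse Q Y * Y = Y := by
  have hrank : Y.rank ≤ (Y * Q).rank := by
    refine hY.trans ?_
    conv_lhs => rw [← compressionInverse_mul_mul hQ hu, Matrix.mul_assoc]
    exact Matrix.rank_mul_le_right _ _
  obtain ⟨W, hW⟩ := exists_eq_mul_of_rank_le hrank
  calc Y * compressionInverse Q Y * Y
      = Y * compressionInverse Q Y * (Y * Q * W) := by rw [← hW]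
    _ = Y * (compressionInverse Q Y * Y * Q) * W := by simp only [Matrix.mul_assoc]
    _ = Y := by rw [compressionInverse_mul_mul hQ hu, ← hW]

end Field

theorem posSemidef_compressionInverse {n : Type*} [Fintype n] [DecidableEq n] {Q Y : Matrix n n ℝ}
    (hQ : Qᵀ = Q) (hY : (completedCompression Q Y).PosDef) :
    (compressionInverse Q Y).PosSemidef := by
  have h := hY.inv.posSemidef.mul_mul_conjTranspose_same Q
  rwa [Matrix.conjTranspose_eq_transpose_of_trivial, hQ] at h

theorem contDiffAt_compressionInverse {n : Type*} [Fintype n] [DecidableEq n] {Q Y : Matrix n n ℝ}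
    (hY : IsUnit (completedCompression Q Y)) {k : WithTop ℕ∞} :
    ContDiffAt ℝ k (compressionInverse Q) Y := by
  have hcompr : ContDiffAt ℝ k (completedCompression Q) Y :=
    ((contDiffAt_const.mul contDiffAt_id).mul contDiffAt_const).add contDiffAt_const
  exact (contDiffAt_const.mul ((contDiffAt_matrix_inv hY).comp Y hcompr)).mul contDiffAt_const

end CompressionInverse

/-! ### The space of symmetric matrices -/

theorem mul_eq_of_mul_eq_of_isSymm {n R : Type*} [Fintype n] [CommSemiring R]
    {L M N : Matrix n n R} (hL : L.IsSymm) (hM : M.IsSymm) (hN : N.IsSymm) (h : M * N = L) :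
    N * M = L := by
  rw [← hL.eq, ← h, Matrix.transpose_mul, hM.eq, hN.eq]

theorem contDiffAt_matrix_transpose {m n : Type*} [Fintype m] [Fintype n] {E : Type*}
    [NormedAddCommGroup E] [NormedSpace ℝ E] {B : E → Matrix m n ℝ} {x : E} {k : WithTop ℕ∞}
    (hB : ContDiffAt ℝ k B x) : ContDiffAt ℝ k (fun y => (B y)ᵀ) x :=
  (Matrix.transposeLinearEquiv m n ℝ ℝ).toLinearMap.toContinuousLinearMap.contDiff.contDiffAt.comp
    x hB

namespace SymMat

variable {n : ℕ}

theorem transpose_coe (X : SymMat n) : (X : Matrix (Fin n) (Fin n) ℝ)ᵀ = X := X.2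

theorem inner_eq_trace (X Y : SymMat n) :
    inner ℝ X Y = ((X : Matrix (Fin n) (Fin n) ℝ) * Y).trace := by
  change ((X : Matrix (Fin n) (Fin n) ℝ)ᵀ * Y).trace = _
  rw [X.transpose_coe]

/-- The congruence transformation `Y ↦ B * Y * Bᵀ` of symmetric matrices. -/
def congruence (B : Matrix (Fin n) (Fin n) ℝ) (Y : SymMat n) : SymMat n :=
  ⟨B * Y * Bᵀ, show (B * Y.1 * Bᵀ)ᵀ = B * Y.1 * Bᵀ by
    rw [Matrix.transpose_mul, Matrix.transpose_mul, Matrix.transpose_transpose, Y.transpose_coe,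
      Matrix.mul_assoc]⟩

theorem coe_congruence (B : Matrix (Fin n) (Fin n) ℝ) (Y : SymMat n) :
    (congruence B Y : Matrix (Fin n) (Fin n) ℝ) = B * Y * Bᵀ := rfl

theorem congruence_mem_psdCone (B : Matrix (Fin n) (Fin n) ℝ) {Y : SymMat n}
    (hY : Y ∈ psdCone n) : congruence B Y ∈ psdCone n := by
  have h := Matrix.PosSemidef.mul_mul_conjTranspose_same hY B
  rwa [Matrix.conjTranspose_eq_transpose_of_trivial] at h

theorem contDiffAt_congruence {E : Type*} [NormedAddCommGroup E] [NormedSpace ℝ E]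
    {B : E → Matrix (Fin n) (Fin n) ℝ} {Y : E → SymMat n} {x : E} {k : WithTop ℕ∞}
    (hB : ContDiffAt ℝ k B x) (hY : ContDiffAt ℝ k Y x) :
    ContDiffAt ℝ k (fun y => congruence (B y) (Y y)) x := by
  exact contDiffAt_subtypeVal_comp_iff.1
    ((hB.mul (contDiffAt_subtypeVal_comp_iff.2 hY)).mul (contDiffAt_matrix_transpose hB))

end SymMat

section Face

variable {m n : ℕ} {A : Matrix (Fin m) (Fin n) ℝ} {X : SymMat n}

theorem convex_facialSubspace_inter_psdCone (A : Matrix (Fin m) (Fin n) ℝ) :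
    Convex ℝ (facialSubspace A ∩ psdCone n) := by
  rintro X ⟨hX, hX'⟩ Y ⟨hY, hY'⟩ a b ha hb -
  refine ⟨?_, Matrix.PosSemidef.add (hX'.smul ha) (hY'.smul hb)⟩
  change A * (a • X.1 + b • Y.1) = 0
  rw [Matrix.mul_add, Matrix.mul_smul, Matrix.mul_smul, show A * X.1 = 0 from hX,
    show A * Y.1 = 0 from hY, smul_zero, smul_zero, add_zero]

theorem fixedRankFace_subset (A : Matrix (Fin m) (Fin n) ℝ) (X : SymMat n) :
    fixedRankFace A X ⊆ facialSubspace A ∩ psdCone n := fun _ hY => ⟨hY.2.1, hY.1⟩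

theorem mem_fixedRankFace_self (hX : X ∈ facialSubspace A ∩ psdCone n) :
    X ∈ fixedRankFace A X := ⟨hX.2, hX.1, rfl⟩

theorem coe_mul_kernelProjection (hX : X ∈ facialSubspace A) : X.1 * kernelProjection A = X :=
  mul_eq_of_mul_eq_of_isSymm X.transpose_coe (transpose_kernelProjection A) X.transpose_coe
    (kernelProjection_mul_eq_self hX)

/-! ### Tangent and normal vectors of the fixed-rank face -/

theorem congruence_mem_fixedRankFace (hX : X ∈ facialSubspace A ∩ psdCone n)
    {U : Matrix (Fin n) (Fin n) ℝ} (hU : IsUnit U.det) (hAU : A * U = A) :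
    SymMat.congruence U X ∈ fixedRankFace A X := by
  refine ⟨SymMat.congruence_mem_psdCone U hX.2, ?_, ?_⟩
  · rw [SymMat.coe_congruence, ← Matrix.mul_assoc, ← Matrix.mul_assoc, hAU,
      show A * X.1 = 0 from hX.1, Matrix.zero_mul]
  · rw [SymMat.coe_congruence, Matrix.rank_mul_eq_left_of_isUnit_det _ _ (U.det_transpose ▸ hU),
      Matrix.rank_mul_eq_right_of_isUnit_det _ _ hU]

theorem SymMat.hasDerivAt_congruence_one_add_smul (E : Matrix (Fin n) (Fin n) ℝ) {v : SymMat n}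
    (hv : v.1 = E * X + X * Eᵀ) :
    HasDerivAt (fun t : ℝ => SymMat.congruence (1 + t • E) X) v 0 := by
  have hpoly : (fun t : ℝ => SymMat.congruence (1 + t • E) X) =
      fun t => X + t • v + t ^ 2 • SymMat.congruence E X := by
    funext t
    apply Subtype.ext
    change (1 + t • E) * X.1 * (1 + t • E)ᵀ = X.1 + t • v.1 + t ^ 2 • (E * X.1 * Eᵀ)
    rw [hv]
    simp only [Matrix.transpose_add, Matrix.transpose_one, Matrix.transpose_smul, Matrix.add_mul,
      Matrix.mul_add, Matrix.one_mul, Matrix.mul_one, Matrix.smul_mul, Matrix.mul_smul, smul_add,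
      smul_smul, sq]
    abel
  have hlin := ((hasDerivAt_id (0 : ℝ)).smul_const v).const_add X
  have hquad := ((hasDerivAt_id (0 : ℝ)).pow 2).smul_const (SymMat.congruence E X)
  rw [hpoly]
  exact (hlin.add hquad).congr_deriv (by simp)

theorem mem_tangentVectors_fixedRankFace (hX : X ∈ facialSubspace A ∩ psdCone n)
    {E : Matrix (Fin n) (Fin n) ℝ} (hE : A * E = 0) {v : SymMat n}
    (hv : v.1 = E * X + X * Eᵀ) : v ∈ tangentVectors (fixedRankFace A X) X := by
  refine ⟨fun t => SymMat.congruence (1 + t • E) X, ?_, ?_, ?_,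
    SymMat.hasDerivAt_congruence_one_add_smul E hv⟩
  · exact Subtype.ext (by simp [SymMat.coe_congruence])
  · have hdet : ∀ᶠ t in 𝓝 (0 : ℝ), (1 + t • E).det ≠ 0 := by
      have hcont : Continuous fun t : ℝ => (1 + t • E).det := by fun_prop
      exact hcont.continuousAt.eventually_ne (by simp)
    filter_upwards [hdet] with t ht
    exact congruence_mem_fixedRankFace hX ht.isUnit (by simp [Matrix.mul_add, hE])
  · exact SymMat.contDiffAt_congruence (by fun_prop) contDiffAt_const

theorem kernelProjection_mul_mul_eq_zero_of_mem_normalSpace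
    (hX : X ∈ facialSubspace A ∩ psdCone n) {S : SymMat n}
    (hS : S ∈ normalSpace (fixedRankFace A X) X) : kernelProjection A * S.1 * X = 0 := by
  set P := kernelProjection A
  set E := P * S.1 * X with hE
  have hEt : Eᵀ = X * S * P := by
    simp [hE, P, Matrix.mul_assoc, X.transpose_coe, S.transpose_coe, transpose_kernelProjection]
  have hAE : A * E = 0 := by simp [hE, P, ← Matrix.mul_assoc, mul_kernelProjection]
  let v : SymMat n := ⟨E * X + X * Eᵀ, by
    change (E * X.1 + X.1 * Eᵀ)ᵀ = _
    simp [X.transpose_coe, add_comm]⟩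
  have horth := (Submodule.mem_orthogonal' _ _).1 hS v
    (Submodule.subset_span (mem_tangentVectors_fixedRankFace hX hAE rfl))
  have htrace : (S.1 * (E * X)).trace = (Eᵀ * E).trace := by
    calc (S.1 * (E * X)).trace = (X.1 * (S * E)).trace := by
          rw [← Matrix.mul_assoc, Matrix.trace_mul_comm]
      _ = (X * S * (P * E)).trace := by
          rw [kernelProjection_mul_eq_self hAE, Matrix.mul_assoc]
      _ = (Eᵀ * E).trace := by rw [hEt, ← Matrix.mul_assoc]
  have htrace' : (S.1 * (X * Eᵀ)).trace = (S.1 * (E * X)).trace := by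
    rw [← Matrix.trace_transpose, Matrix.transpose_mul, Matrix.transpose_mul, X.transpose_coe,
      S.transpose_coe, Matrix.transpose_transpose, Matrix.trace_mul_comm]
  rw [SymMat.inner_eq_trace, Matrix.mul_add, Matrix.trace_add, htrace', htrace] at horth
  rw [← Matrix.trace_conjTranspose_mul_self_eq_zero_iff,
    Matrix.conjTranspose_eq_transpose_of_trivial]
  linarith

/-! ### The subdifferential of the indicator function -/

theorem posSemidef_neg_compression_of_mem_subdifferential
    (hX : X ∈ facialSubspace A ∩ psdCone n) {S : SymMat n}
    (hS : S ∈ subdifferential (convexIndicator (facialSubspace A ∩ psdCone n)) X) :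
    (-(kernelProjection A * S.1 * kernelProjection A)).PosSemidef := by
  set P := kernelProjection A with hP
  have hPt : Pᵀ = P := transpose_kernelProjection A
  refine .of_dotProduct_mulVec_nonneg ?_ fun x => ?_
  · change (-(P * S.1 * P))ᵀ = _
    simp [Matrix.mul_assoc, S.transpose_coe, hPt]
  let w : SymMat n := ⟨Matrix.vecMulVec (P *ᵥ x) (P *ᵥ x), Matrix.transpose_vecMulVec _ _⟩
  have hw : X + w ∈ facialSubspace A ∩ psdCone n := by
    refine ⟨?_, hX.2.add (Matrix.posSemidef_vecMulVec_self_star _)⟩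
    change A * (X.1 + Matrix.vecMulVec (P *ᵥ x) (P *ᵥ x)) = 0
    rw [Matrix.mul_add, show A * X.1 = 0 from hX.1, Matrix.mul_vecMulVec, Matrix.mulVec_mulVec,
      hP, mul_kernelProjection]
    simp
  have hle := (mem_subdifferential_convexIndicator_iff hX).1 hS _ hw
  have htrace : (S.1 * w).trace = x ⬝ᵥ (P * S.1 * P) *ᵥ x := by
    change (S.1 * Matrix.vecMulVec (P *ᵥ x) (P *ᵥ x)).trace = _
    rw [Matrix.mul_vecMulVec, Matrix.trace_vecMulVec, dotProduct_comm, ← Matrix.mulVec_mulVec,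
      ← Matrix.mulVec_mulVec, Matrix.dotProduct_mulVec x, ← Matrix.mulVec_transpose, hPt]
  rw [add_sub_cancel_left, SymMat.inner_eq_trace, htrace] at hle
  rw [Matrix.neg_mulVec, dotProduct_neg, star_trivial]
  exact neg_nonneg.2 hle

-- On `ker A`, the cone is the full cone of positive semidefinite forms, which is self-dual.
theorem mem_subdifferential_iff (hX : X ∈ facialSubspace A ∩ psdCone n) {S : SymMat n} :
    S ∈ subdifferential (convexIndicator (facialSubspace A ∩ psdCone n)) X ↔
      kernelProjection A * S.1 * X = 0 ∧
        (-(kernelProjection A * S.1 * kernelProjection A)).PosSemidef := by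
  refine ⟨fun hS => ⟨?_, posSemidef_neg_compression_of_mem_subdifferential hX hS⟩,
    fun ⟨hSX, hneg⟩ => (mem_subdifferential_convexIndicator_iff hX).2 fun Y hY => ?_⟩
  · exact kernelProjection_mul_mul_eq_zero_of_mem_normalSpace hX
      (subdifferential_convexIndicator_subset_normalSpace (fixedRankFace_subset A X) hX hS)
  set P := kernelProjection A
  have hSX_trace : (S.1 * X).trace = 0 := by
    rw [← coe_mul_kernelProjection hX.1, ← Matrix.mul_assoc, Matrix.trace_mul_comm,
      ← Matrix.mul_assoc, hSX, Matrix.trace_zero]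
  have hSY_trace : (S.1 * Y).trace = -(-(P * S.1 * P) * Y).trace := by
    conv_lhs => rw [← coe_mul_kernelProjection hY.1, ← Matrix.mul_assoc, Matrix.trace_mul_comm,
      ← kernelProjection_mul_eq_self hY.1]
    simp only [Matrix.neg_mul, Matrix.trace_neg, neg_neg, Matrix.mul_assoc, P]
  rw [inner_sub_right, SymMat.inner_eq_trace, SymMat.inner_eq_trace, hSX_trace, hSY_trace]
  linarith [trace_mul_nonneg_of_posSemidef hneg hY.2]

theorem kernelProjection_mul_congruence (A : Matrix (Fin m) (Fin n) ℝ) (S : SymMat n) :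
    kernelProjection A * (SymMat.congruence (kernelProjection A) S).1 =
      SymMat.congruence (kernelProjection A) S := by
  rw [SymMat.coe_congruence, ← Matrix.mul_assoc, ← Matrix.mul_assoc,
    (isStarProjection_kernelProjection A).isIdempotentElem.eq]

theorem kernelProjection_mul_congruence_mul_kernelProjection (A : Matrix (Fin m) (Fin n) ℝ)
    (S : SymMat n) :
    kernelProjection A * (SymMat.congruence (kernelProjection A) S).1 * kernelProjection A =
      kernelProjection A * S.1 * kernelProjection A := by
  rw [kernelProjection_mul_congruence, SymMat.coe_congruence, transpose_kernelProjection,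
    Matrix.mul_assoc _ _ (kernelProjection A),
    (isStarProjection_kernelProjection A).isIdempotentElem.eq]

theorem congruence_kernelProjection_mul_eq_zero (hX : X ∈ facialSubspace A) {S : SymMat n}
    (hS : kernelProjection A * S.1 * X = 0) :
    (SymMat.congruence (kernelProjection A) S).1 * X = 0 := by
  rw [SymMat.coe_congruence, transpose_kernelProjection, Matrix.mul_assoc,
    kernelProjection_mul_eq_self hX, hS]

theorem mem_subdifferential_of_compression_eq_neg_sq (hX : X ∈ facialSubspace A ∩ psdCone n)
    {S B : SymMat n} (hSX : kernelProjection A * S.1 * X = 0)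
    (hB : kernelProjection A * S.1 * kernelProjection A =
      -(kernelProjection A * (B.1 * B.1) * kernelProjection A)) :
    S ∈ subdifferential (convexIndicator (facialSubspace A ∩ psdCone n)) X := by
  refine (mem_subdifferential_iff hX).2 ⟨hSX, ?_⟩
  have h := Matrix.posSemidef_self_mul_conjTranspose (kernelProjection A * B.1)
  rw [Matrix.conjTranspose_eq_transpose_of_trivial, Matrix.transpose_mul, B.transpose_coe,
    transpose_kernelProjection] at h
  rw [hB, neg_neg]
  simpa only [Matrix.mul_assoc] using h

-- For `D = P * S * P` and `N` the projection onto `ker X`, we have `D * N = N * D = D`, so the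
-- identity `4 * D = (D + N) ^ 2 - (D - N) ^ 2` exhibits the compression of `S` as a difference of
-- two semidefinite matrices vanishing on the range of `X`.
theorem exists_sub_eq_of_kernelProjection_mul_mul_eq_zero
    (hX : X ∈ facialSubspace A ∩ psdCone n) {S : SymMat n}
    (hS : kernelProjection A * S.1 * X = 0) :
    ∃ S₁ ∈ subdifferential (convexIndicator (facialSubspace A ∩ psdCone n)) X,
      ∃ S₂ ∈ subdifferential (convexIndicator (facialSubspace A ∩ psdCone n)) X, S₁ - S₂ = S := by
  let D := SymMat.congruence (kernelProjection A) S
  let N : SymMat n := ⟨kernelProjection X.1, transpose_kernelProjection X.1⟩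
  have hDX : D.1 * X.1 = 0 := congruence_kernelProjection_mul_eq_zero hX.1 hS
  have hNX : N.1 * X.1 = 0 := mul_eq_of_mul_eq_of_isSymm Matrix.isSymm_zero X.2 N.2
    (mul_kernelProjection X.1)
  have hND : N.1 * D.1 = D.1 := kernelProjection_mul_eq_self
    (mul_eq_of_mul_eq_of_isSymm Matrix.isSymm_zero D.2 X.2 hDX)
  have hDN : D.1 * N.1 = D.1 := mul_eq_of_mul_eq_of_isSymm D.2 N.2 D.2 hND
  let U : SymMat n := (1 / 2 : ℝ) • (D + N)
  let V : SymMat n := (1 / 2 : ℝ) • (D - N)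
  have hD_sq : D.1 - U.1 * U.1 = -(V.1 * V.1) := by
    simp only [U, V, Submodule.coe_smul, Submodule.coe_add, Submodule.coe_sub, Matrix.smul_mul,
      Matrix.mul_smul, Matrix.add_mul, Matrix.mul_add, Matrix.sub_mul, Matrix.mul_sub, hND, hDN]
    module
  have hUX : U.1 * X.1 = 0 := by
    simp only [U, Submodule.coe_smul, Submodule.coe_add, Matrix.smul_mul, Matrix.add_mul, hDX, hNX,
      add_zero, smul_zero]
  let W : SymMat n := ⟨-(U.1 * U.1), show (-(U.1 * U.1))ᵀ = _ by
    rw [Matrix.transpose_neg, Matrix.transpose_mul, U.transpose_coe]⟩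
  have hWX : kernelProjection A * W.1 * X = 0 := by
    simp only [W, Matrix.mul_neg, Matrix.neg_mul, Matrix.mul_assoc, hUX, Matrix.mul_zero, neg_zero]
  refine ⟨S + W, mem_subdifferential_of_compression_eq_neg_sq hX (B := V) ?_ ?_,
    W, mem_subdifferential_of_compression_eq_neg_sq hX (B := U) hWX ?_, add_sub_cancel_right S W⟩
  · rw [Submodule.coe_add, Matrix.mul_add, Matrix.add_mul, hS, hWX, add_zero]
  · rw [Submodule.coe_add, Matrix.mul_add, Matrix.add_mul,
      ← kernelProjection_mul_congruence_mul_kernelProjection, ← Matrix.add_mul, ← Matrix.mul_add,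
      ← sub_eq_add_neg, hD_sq, Matrix.mul_neg, Matrix.neg_mul]
  · rw [Matrix.mul_neg, Matrix.neg_mul]

theorem affineSpan_subdifferential_convexIndicator (hX : X ∈ facialSubspace A ∩ psdCone n) :
    affineSpan ℝ (subdifferential (convexIndicator (facialSubspace A ∩ psdCone n)) X) =
      AffineSubspace.mk' 0 (normalSpace (fixedRankFace A X) X) := by
  apply le_antisymm
  · rw [affineSpan_le]
    intro S hS
    simpa using subdifferential_convexIndicator_subset_normalSpace (fixedRankFace_subset A X) hX hS
  · intro S hS
    have hSN : S ∈ normalSpace (fixedRankFace A X) X := by simpa using hS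
    obtain ⟨S₁, h₁, S₂, h₂, rfl⟩ := exists_sub_eq_of_kernelProjection_mul_mul_eq_zero hX
      (kernelProjection_mul_mul_eq_zero_of_mem_normalSpace hX hSN)
    simpa using AffineSubspace.smul_vsub_vadd_mem _ (1 : ℝ) (subset_affineSpan ℝ _ h₁)
      (subset_affineSpan ℝ _ h₂)
      (subset_affineSpan ℝ _ (zero_mem_subdifferential_convexIndicator hX))

/-! ### The fixed-rank face as the fixed-point set of a retraction -/

/-- The orthogonal projection onto the orthogonal complement of the kernel of `X`, which is the
range of `X` when `X` is symmetric. -/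
noncomputable def supportProjection (X : SymMat n) : Matrix (Fin n) (Fin n) ℝ :=
  1 - kernelProjection X.1

theorem isIdempotentElem_supportProjection (X : SymMat n) :
    IsIdempotentElem (supportProjection X) :=
  (isStarProjection_kernelProjection X.1).isIdempotentElem.one_sub

theorem transpose_supportProjection (X : SymMat n) :
    (supportProjection X)ᵀ = supportProjection X := by
  rw [supportProjection, Matrix.transpose_sub, Matrix.transpose_one, transpose_kernelProjection]

theorem coe_mul_supportProjection (X : SymMat n) : X.1 * supportProjection X = X := by
  rw [supportProjection, Matrix.mul_sub, mul_kernelProjection, Matrix.mul_one, sub_zero]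

theorem supportProjection_mul_coe (X : SymMat n) : supportProjection X * X.1 = X :=
  mul_eq_of_mul_eq_of_isSymm X.transpose_coe X.transpose_coe (transpose_supportProjection X)
    (coe_mul_supportProjection X)

theorem supportProjection_mul_kernelProjection (hX : X ∈ facialSubspace A) :
    supportProjection X * kernelProjection A = supportProjection X := by
  have h : X.1 * (1 - kernelProjection A) = 0 := by
    rw [Matrix.mul_sub, Matrix.mul_one, coe_mul_kernelProjection hX, sub_self]
  have h' : supportProjection X * (1 - kernelProjection A) = 0 := by
    rw [supportProjection, Matrix.sub_mul, Matrix.one_mul, kernelProjection_mul_eq_self h, sub_self]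
  rwa [Matrix.mul_sub, Matrix.mul_one, sub_eq_zero, eq_comm] at h'

theorem kernelProjection_mul_supportProjection (hX : X ∈ facialSubspace A) :
    kernelProjection A * supportProjection X = supportProjection X :=
  mul_eq_of_mul_eq_of_isSymm (transpose_supportProjection X) (transpose_supportProjection X)
    (transpose_kernelProjection A) (supportProjection_mul_kernelProjection hX)

theorem posDef_completedCompression_supportProjection (hX : X ∈ psdCone n) :
    (completedCompression (supportProjection X) X.1).PosDef := by
  rw [completedCompression, supportProjection_mul_coe, coe_mul_supportProjection,
    supportProjection, sub_sub_cancel]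
  exact posDef_add_kernelProjection hX

theorem rank_supportProjection (hX : X ∈ psdCone n) : (supportProjection X).rank = X.1.rank := by
  apply le_antisymm
  · exact rank_le_of_isUnit_completedCompression (isIdempotentElem_supportProjection X)
      (posDef_completedCompression_supportProjection hX).isUnit
  · conv_lhs => rw [← coe_mul_supportProjection X]
    exact Matrix.rank_mul_le_right _ _

theorem eventually_posDef_completedCompression (hX : X ∈ psdCone n) :
    ∀ᶠ Y : SymMat n in 𝓝 X, (completedCompression (supportProjection X) Y.1).PosDef := by
  have hcont : Continuous fun Y : SymMat n => completedCompression (supportProjection X) Y.1 :=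
    ((continuous_const.mul continuous_subtype_val).mul continuous_const).add continuous_const
  filter_upwards [hcont.continuousAt.eventually
    (eventually_posDef_of_isHermitian (posDef_completedCompression_supportProjection hX))]
    with Y hY
  exact hY (transpose_completedCompression (transpose_supportProjection X) Y.transpose_coe)

/-- Near a point `X` of the face, a retraction of the symmetric matrices onto the fixed-rank face
through `X`. Writing `P` for the projection onto `ker A` and `G` for the inverse of the compression
of `Y` to the range of `X`, it sends `Y` to `P * Y * G * Y * P`: a `Y` of the rank of `X` is
determined by its columns over the range of `X`. -/
noncomputable def faceRetraction (A : Matrix (Fin m) (Fin n) ℝ) (X Y : SymMat n) : SymMat n :=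
  SymMat.congruence (kernelProjection A * Y.1 * compressionInverse (supportProjection X) Y.1) Y

theorem coe_faceRetraction (A : Matrix (Fin m) (Fin n) ℝ) {Y : SymMat n}
    (hu : IsUnit (completedCompression (supportProjection X) Y.1)) :
    (faceRetraction A X Y).1 = kernelProjection A * Y *
      compressionInverse (supportProjection X) Y.1 * Y * kernelProjection A := by
  have hGYG := compressionInverse_mul_mul_compressionInverse
    (isIdempotentElem_supportProjection X) hu
  have hGt := transpose_compressionInverse (transpose_supportProjection X) Y.transpose_coe
  set P := kernelProjection A with hP
  set G := compressionInverse (supportProjection X) Y.1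
  calc (faceRetraction A X Y).1 = P * Y.1 * G * Y.1 * (P * Y.1 * G)ᵀ := rfl
    _ = P * Y.1 * (G * Y.1 * G) * Y.1 * P := by
        rw [Matrix.transpose_mul, Matrix.transpose_mul, hGt, Y.transpose_coe, hP,
          transpose_kernelProjection]
        simp only [Matrix.mul_assoc]
    _ = P * Y.1 * G * Y.1 * P := by rw [hGYG]

theorem supportProjection_mul_faceRetraction_mul (hX : X ∈ facialSubspace A) {Y : SymMat n}
    (hu : IsUnit (completedCompression (supportProjection X) Y.1)) :
    supportProjection X * (faceRetraction A X Y).1 * supportProjection X =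
      supportProjection X * Y.1 * supportProjection X := by
  rw [coe_faceRetraction A hu]
  set P := kernelProjection A
  set Q := supportProjection X
  set G := compressionInverse Q Y.1
  calc Q * (P * Y.1 * G * Y * P) * Q = Q * P * Y.1 * G * Y * (P * Q) := by
        simp only [Matrix.mul_assoc]
    _ = Q * Y.1 * G * Y * Q := by
        rw [supportProjection_mul_kernelProjection hX, kernelProjection_mul_supportProjection hX]
    _ = Q * Y.1 * Q := by
        rw [mul_mul_compressionInverse (isIdempotentElem_supportProjection X) hu]

theorem kernelProjection_mul_compressionInverse_mul (hX : X ∈ facialSubspace A)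
    (Y : Matrix (Fin n) (Fin n) ℝ) :
    kernelProjection A * compressionInverse (supportProjection X) Y * kernelProjection A =
      compressionInverse (supportProjection X) Y := by
  have hQ := isIdempotentElem_supportProjection X
  rw [← mul_compressionInverse hQ, ← Matrix.mul_assoc, kernelProjection_mul_supportProjection hX,
    mul_compressionInverse hQ, ← compressionInverse_mul hQ, Matrix.mul_assoc,
    supportProjection_mul_kernelProjection hX]

theorem faceRetraction_faceRetraction (hX : X ∈ facialSubspace A) {Y : SymMat n}
    (hu : IsUnit (completedCompression (supportProjection X) Y.1)) :
    faceRetraction A X (faceRetraction A X Y) = faceRetraction A X Y := by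
  have hcompr := supportProjection_mul_faceRetraction_mul hX hu
  have hPGP := kernelProjection_mul_compressionInverse_mul hX Y.1
  have hPP := (isStarProjection_kernelProjection A).isIdempotentElem.eq
  have hGYG := compressionInverse_mul_mul_compressionInverse
    (isIdempotentElem_supportProjection X) hu
  have hu' : IsUnit (completedCompression (supportProjection X) (faceRetraction A X Y).1) := by
    rwa [completedCompression, hcompr]
  apply Subtype.ext
  rw [coe_faceRetraction A hu', compressionInverse_congr hcompr, coe_faceRetraction A hu]
  set P := kernelProjection A
  set G := compressionInverse (supportProjection X) Y.1
  calc P * (P * Y.1 * G * Y * P) * G * (P * Y.1 * G * Y * P) * P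
      = P * P * Y.1 * G * Y * (P * G * P) * Y.1 * G * Y * (P * P) := by
        simp only [Matrix.mul_assoc]
    _ = P * Y.1 * (G * Y * G * Y * G) * Y * P := by
        rw [hPP, hPGP]
        simp only [Matrix.mul_assoc]
    _ = P * Y.1 * G * Y * P := by rw [hGYG, hGYG]

theorem mem_fixedRankFace_iff_faceRetraction_eq (hX : X ∈ facialSubspace A ∩ psdCone n)
    {Y : SymMat n} (hY : (completedCompression (supportProjection X) Y.1).PosDef) :
    Y ∈ fixedRankFace A X ↔ faceRetraction A X Y = Y := by
  have hQ := isIdempotentElem_supportProjection X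
  have hrank := rank_supportProjection hX.2
  have hcoe := coe_faceRetraction A hY.isUnit
  refine ⟨fun hYM => Subtype.ext ?_, fun hρY => ?_⟩
  · rw [hcoe, kernelProjection_mul_eq_self hYM.2.1,
      mul_compressionInverse_mul_of_rank_le hQ hY.isUnit (hYM.2.2.trans hrank.symm).le,
      coe_mul_kernelProjection hYM.2.1]
  rw [hρY] at hcoe
  refine ⟨?_, ?_, le_antisymm ?_ ?_⟩
  · have hG := posSemidef_compressionInverse (transpose_supportProjection X) hY
    have h := hG.mul_mul_conjTranspose_same (kernelProjection A * Y.1)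
    rw [Matrix.conjTranspose_eq_transpose_of_trivial, Matrix.transpose_mul, Y.transpose_coe,
      transpose_kernelProjection, ← Matrix.mul_assoc, ← hcoe] at h
    exact h
  · rw [hcoe]
    simp only [← Matrix.mul_assoc, mul_kernelProjection, Matrix.zero_mul]
  · calc Y.1.rank ≤ (compressionInverse (supportProjection X) Y.1).rank := by
          conv_lhs => rw [hcoe, Matrix.mul_assoc, Matrix.mul_assoc (kernelProjection A * Y.1)]
          exact (Matrix.rank_mul_le_right _ _).trans (Matrix.rank_mul_le_left _ _)
      _ ≤ (supportProjection X).rank := by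
          rw [← mul_compressionInverse hQ]
          exact Matrix.rank_mul_le_left _ _
      _ = X.1.rank := hrank
  · exact hrank.symm.trans_le (rank_le_of_isUnit_completedCompression hQ hY.isUnit)

theorem contDiffAt_faceRetraction (hX : X ∈ psdCone n) {k : WithTop ℕ∞} :
    ContDiffAt ℝ k (faceRetraction A X) X := by
  have hcoe : ContDiffAt ℝ k (fun Y : SymMat n => Y.1) X :=
    contDiffAt_subtypeVal_comp_iff.2 contDiffAt_id
  refine SymMat.contDiffAt_congruence ((contDiffAt_const.mul hcoe).mul ?_) contDiffAt_id
  exact (contDiffAt_compressionInverse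
    (posDef_completedCompression_supportProjection hX).isUnit).comp X hcoe

theorem isC2ManifoldAround_fixedRankFace (hX : X ∈ facialSubspace A ∩ psdCone n) :
    IsC2ManifoldAround (fixedRankFace A X) X := by
  have hpos := eventually_posDef_completedCompression hX.2
  refine isC2ManifoldAround_of_retraction (contDiffAt_faceRetraction hX.2) ?_
    (hpos.mono fun Y hY => faceRetraction_faceRetraction hX.1 hY.isUnit)
    (hpos.mono fun Y hY => mem_fixedRankFace_iff_faceRetraction_eq hX hY)
  exact (mem_fixedRankFace_iff_faceRetraction_eq hX hpos.self_of_nhds).1 (mem_fixedRankFace_self hX)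

/-! ### Inner semicontinuity -/

theorem congruence_add_sub_mem_subdifferential {Y S : SymMat n}
    (hY : Y ∈ facialSubspace A ∩ psdCone n)
    (hS : (-(kernelProjection A * S.1 * kernelProjection A)).PosSemidef)
    {R : Matrix (Fin n) (Fin n) ℝ} (hR : R * Y.1 = Y) :
    SymMat.congruence (1 - R)ᵀ (SymMat.congruence (kernelProjection A) S) +
        (S - SymMat.congruence (kernelProjection A) S) ∈
      subdifferential (convexIndicator (facialSubspace A ∩ psdCone n)) Y := by
  have hPt : (kernelProjection A)ᵀ = kernelProjection A := transpose_kernelProjection A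
  have hPD := kernelProjection_mul_congruence A S
  have hPDP := kernelProjection_mul_congruence_mul_kernelProjection A S
  have hPY := kernelProjection_mul_eq_self hY.1
  rw [mem_subdifferential_iff hY]
  set P := kernelProjection A
  let D := SymMat.congruence P S
  have hD : D.1 = P * S.1 * P := congr(P * S.1 * $hPt)
  have hσ : (SymMat.congruence (1 - R)ᵀ D + (S - D)).1 =
      (1 - R)ᵀ * D.1 * (1 - R) + (S.1 - D.1) :=
    congr((1 - R)ᵀ * D.1 * $(Matrix.transpose_transpose (1 - R)) + (S.1 - D.1))
  constructor
  · have hRY : (1 - R) * Y.1 = 0 := by rw [Matrix.sub_mul, Matrix.one_mul, hR, sub_self]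
    have hPSY : P * (S.1 - D.1) * Y.1 = 0 := by
      rw [Matrix.mul_sub, Matrix.sub_mul, hPD, hD, Matrix.mul_assoc _ P, hPY, sub_self]
    rw [hσ, Matrix.mul_add, Matrix.add_mul, hPSY, Matrix.mul_assoc, Matrix.mul_assoc, hRY,
      Matrix.mul_zero, Matrix.mul_zero, add_zero]
  · have hPSP : P * (S.1 - D.1) * P = 0 := by
      rw [Matrix.mul_sub, Matrix.sub_mul, hPDP, sub_self]
    have h := hS.mul_mul_conjTranspose_same (P * (1 - R)ᵀ)
    rw [← hD, Matrix.conjTranspose_eq_transpose_of_trivial, Matrix.transpose_mul,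
      Matrix.transpose_transpose, hPt] at h
    rw [hσ, Matrix.mul_add, Matrix.add_mul, hPSP, add_zero]
    simpa only [Matrix.mul_neg, Matrix.neg_mul, Matrix.mul_assoc] using h

-- The compression `P * S * P` is transported to `Y` by the oblique projection `1 - Y * G` along
-- the range of `Y`.
theorem innerSemicontinuousRel_subdifferential_convexIndicator
    (hX : X ∈ facialSubspace A ∩ psdCone n) :
    InnerSemicontinuousRel (subdifferential (convexIndicator (facialSubspace A ∩ psdCone n)))
      (fixedRankFace A X) X := by
  refine innerSemicontinuousRel_of_forall_exists_continuousAt fun S hS => ?_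
  obtain ⟨hSX, hneg⟩ := (mem_subdifferential_iff hX).1 hS
  have hu := (posDef_completedCompression_supportProjection hX.2).isUnit
  let D := SymMat.congruence (kernelProjection A) S
  let R : SymMat n → Matrix (Fin n) (Fin n) ℝ := fun Y =>
    Y * compressionInverse (supportProjection X) Y.1
  have hDX : D.1 * X = 0 := congruence_kernelProjection_mul_eq_zero hX.1 hSX
  refine ⟨fun Y => SymMat.congruence (1 - R Y)ᵀ D + (S - D), ?_, ?_, ?_⟩
  · have hcoe : ContDiffAt ℝ 0 (fun Y : SymMat n => Y.1) X :=
      contDiffAt_subtypeVal_comp_iff.2 contDiffAt_id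
    have hR : ContDiffAt ℝ 0 R X := hcoe.mul ((contDiffAt_compressionInverse hu).comp X hcoe)
    exact ((SymMat.contDiffAt_congruence (contDiffAt_matrix_transpose (contDiffAt_const.sub hR))
      contDiffAt_const).add contDiffAt_const).continuousAt
  · have hDR : D.1 * (1 - R X) = D.1 := by
      rw [Matrix.mul_sub, Matrix.mul_one, ← Matrix.mul_assoc, hDX, Matrix.zero_mul, sub_zero]
    have hRD : (1 - R X)ᵀ * D.1 = D.1 := by
      have h := congr(($hDR)ᵀ)
      rwa [Matrix.transpose_mul, D.transpose_coe] at h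
    have hσ : SymMat.congruence (1 - R X)ᵀ D = D := Subtype.ext <| by
      rw [SymMat.coe_congruence, hRD, Matrix.transpose_transpose, hDR]
    simp only [hσ, add_sub_cancel]
  · filter_upwards [self_mem_nhdsWithin,
      (eventually_posDef_completedCompression hX.2).filter_mono nhdsWithin_le_nhds] with Y hYM hY
    refine congruence_add_sub_mem_subdifferential (fixedRankFace_subset A X hYM) hneg ?_
    exact mul_compressionInverse_mul_of_rank_le (isIdempotentElem_supportProjection X) hY.isUnit
      (hYM.2.2.trans (rank_supportProjection hX.2).symm).le

end Face

theorem mainTheorem2 {m n : ℕ} (A : Matrix (Fin m) (Fin n) ℝ) (X : SymMat n)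
    (hX : X ∈ facialSubspace A ∩ psdCone n) :
    IsPartlySmooth (convexIndicator (facialSubspace A ∩ psdCone n)) (fixedRankFace A X) X where
  convex := isConvexFun_convexIndicator (convex_facialSubspace_inter_psdCone A)
  mem := mem_fixedRankFace_self hX
  subdifferential_nonempty := ⟨0, zero_mem_subdifferential_convexIndicator hX⟩
  manifold := isC2ManifoldAround_fixedRankFace hX
  smooth := ⟨0, contDiffAt_const, eventually_nhdsWithin_of_forall fun _ hY =>
    convexIndicator_of_mem (fixedRankFace_subset A X hY)⟩
  sharp := ⟨0, affineSpan_subdifferential_convexIndicator hX⟩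
  outer := outerSemicontinuousRel_subdifferential_convexIndicator (fixedRankFace_subset A X) hX
  inner := innerSemicontinuousRel_subdifferential_convexIndicator hX
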